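/- Let $d\in\mathbb N$, $\sigma_a,\sigma_A>0$, $\sigma_b\ge 0$, and let $\mathbb X$ be the space of continuous paths $x:[0,1]\to\mathbb R^d$ with $x(0)=0$ that have a derivative $\dot x\in L^2([0,1];\mathbb R^d)$, i.e. $x_t=\int_0^t\dot x_u\,du$. For an activation function $\varphi:\mathbb R\to\mathbb R$ the neural signature kernel $\mathcal K_\varphi=(\mathcal K_\varphi^{x,y})_{x,y\in\mathbb X}$ is the solution, in the class of families of continuous functions $\mathcal K^{x,y}:[0,1]^2\to\mathbb R$ for which all matrices $\Sigma^{x,y}(s,t)$ below are positive semidefinite, of $$\mathcal K^{x,y}(s,t)=\sigma_a^2+\int_0^s\!\int_0^t\Big[\sigma_A^2\,\mathbb E_{Z\sim\mathcal N(0,\Sigma^{x,y}(\eta,\tau))}[\varphi(Z_1)\varphi(Z_2)]+\sigma_b^2\Big]\langle\dot x_\eta,\dot y_\tau\rangle\,d\tau\,d\eta,\qquad \Sigma^{x,y}(s,t)=\begin{pmatrix}\mathcal K^{x,x}(s,s)&\mathcal K^{x,y}(s,t)\\ \mathcal K^{x,y}(s,t)&\mathcal K^{y,y}(t,t)\end{pmatrix}$$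 for all $x,y\in\mathbb X$ and $s,t\in[0,1]$. The signature kernel is $$k_{sig}^{x,y}(s,t)=\sum_{n\ge0}\ \sum_{w\in\{1,\dots,d\}^n}S^w_s(x)\,S^w_t(y),\qquad S^{w}_t(x)=\int_{0<u_1<\dots<u_n<t}dx^{w_1}_{u_1}\cdots dx^{w_n}_{u_n},\quad S^{\emptyset}_t(x)=1 .$$ Then for the identity activation $\varphi=\mathrm{id}$ this equation has exactly one solution $\mathcal K_{\mathrm{id}}$ in the above class, and for all $x,y\in\mathbb X$ and $s,t\in[0,1]$ the series (over $n$) defining $k_{sig}^{\sigma_A x,\sigma_A y}(s,t)$ converges absolutely and $$\mathcal K_{\mathrm{id}}^{x,y}(s,t)=\Big(\sigma_a^2+\frac{\sigma_b^2}{\sigma_A^2}\Big)\,k_{sig}^{\sigma_A x,\sigma_A y}(s,t)-\frac{\sigma_b^2}{\sigma_A^2}.$$ -/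

import Mathlib

open MeasureTheory ProbabilityTheory
open scoped RealInnerProductSpace unitInterval

namespace NeuralSig

/-- `v` is a square integrable derivative on `[0,1]` of the path `x` started at the origin:
`x t = ∫₀ᵗ v u du` for all `t ∈ [0,1]`. -/
def IsL2Deriv {d : ℕ} (x : C(I, EuclideanSpace ℝ (Fin d)))
    (v : ℝ → EuclideanSpace ℝ (Fin d)) : Prop :=
  MemLp v 2 (volume.restrict (Set.Icc (0 : ℝ) 1)) ∧
    ∀ t : I, x t = ∫ u in (0 : ℝ)..(t : ℝ), v u

theorem IsL2Deriv.intervalIntegrable {d : ℕ} {x : C(I, EuclideanSpace ℝ (Fin d))}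
    {v : ℝ → EuclideanSpace ℝ (Fin d)} (h : IsL2Deriv x v) (t : I) :
    IntervalIntegrable v volume 0 (t : ℝ) := by
  have h1 : IntegrableOn v (Set.Icc (0 : ℝ) 1) volume := h.1.integrable (by norm_num)
  rw [intervalIntegrable_iff_integrableOn_Ioc_of_le t.2.1]
  exact h1.mono_set fun u hu => ⟨hu.1.le, hu.2.trans t.2.2⟩

/-- The data space: continuous paths `x : [0,1] → ℝᵈ` with `x 0 = 0` and
a square integrable derivative. -/
def PathSpace (d : ℕ) : Submodule ℝ C(I, EuclideanSpace ℝ (Fin d)) where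
  carrier := {x | x 0 = 0 ∧ ∃ v, IsL2Deriv x v}
  zero_mem' := ⟨rfl, 0, MemLp.zero, by simp⟩
  add_mem' := by
    rintro x y ⟨hx, v, hv⟩ ⟨hy, w, hw⟩
    refine ⟨by simp [hx, hy], v + w, hv.1.add hw.1, fun t => ?_⟩
    rw [ContinuousMap.add_apply, hv.2 t, hw.2 t,
      ← intervalIntegral.integral_add (hv.intervalIntegrable t) (hw.intervalIntegrable t)]
    rfl
  smul_mem' := by
    rintro c x ⟨hx, v, hv⟩
    refine ⟨by simp [hx], c • v, hv.1.const_smul c, fun t => ?_⟩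
    rw [ContinuousMap.smul_apply, hv.2 t, ← intervalIntegral.integral_smul]
    rfl

/-- The derivative `ẋ ∈ L²([0,1]; ℝᵈ)` of a path; it is unique almost everywhere on `[0,1]`. -/
noncomputable def dot {d : ℕ} (x : PathSpace d) : ℝ → EuclideanSpace ℝ (Fin d) :=
  x.2.2.choose

theorem isL2Deriv_dot {d : ℕ} (x : PathSpace d) : IsL2Deriv x.1 (dot x) :=
  x.2.2.choose_spec

/-- The `n`-th level of the signature of `x` over `[0,t]`, an element of `(ℝᵈ)^{⊗ n}` written in
the orthonormal basis `e_{w 0} ⊗ ⋯ ⊗ e_{w (n-1)}`: the coordinate of the word `w` is the iterated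
integral `∫_{0 < u₁ < ⋯ < uₙ < t} dx^{w 0}_{u₁} ⋯ dx^{w (n-1)}_{uₙ}`. -/
noncomputable def sigLevel {d : ℕ} (x : PathSpace d) :
    (n : ℕ) → ℝ → EuclideanSpace ℝ (Fin n → Fin d)
  | 0, _ => WithLp.toLp 2 fun _ => 1
  | n + 1, t => WithLp.toLp 2 fun w =>
      ∫ u in (0 : ℝ)..t, sigLevel x n u (Fin.init w) * dot x u (w (Fin.last n))

/-- The signature kernel `k_sig^{x,y}(s,t) = ⟨Sig(x)_{[0,s]}, Sig(y)_{[0,t]}⟩`, the inner product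
of the signatures in `⨁ₙ (ℝᵈ)^{⊗ n}`. -/
noncomputable def sigKernel {d : ℕ} (x y : PathSpace d) (s t : ℝ) : ℝ :=
  ∑' n : ℕ, ⟪sigLevel x n s, sigLevel y n t⟫

/-- `V_φ(Σ) = 𝔼_{Z ∼ 𝒩(0,Σ)}[φ(Z₁) φ(Z₂)]`, for positive semidefinite `Σ`. -/
noncomputable def gaussV (φ : ℝ → ℝ) (S : Matrix (Fin 2) (Fin 2) ℝ) : ℝ :=
  ∫ z, φ (z 0) * φ (z 1) ∂(multivariateGaussian 0 S)

/-- The matrix `Σ^{x,y}(s,t)` with rows `(K^{x,x}(s,s), K^{x,y}(s,t))` and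
`(K^{x,y}(s,t), K^{y,y}(t,t))`. -/
def covMat {d : ℕ} (K : PathSpace d → PathSpace d → ℝ → ℝ → ℝ) (x y : PathSpace d) (s t : ℝ) :
    Matrix (Fin 2) (Fin 2) ℝ :=
  !![K x x s s, K x y s t; K x y s t, K y y t t]

/-- `K = (K^{x,y})` is a solution on `[0,1]²` of
`∂ₛ∂ₜ K^{x,y} = (σ_A² V_φ(Σ^{x,y}) + σ_b²) ⟨ẋ_s, ẏ_t⟩`,
`K^{x,y}(0,0) = K^{x,y}(s,0) = K^{x,y}(0,t) = σ_a²`,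
in the integrated sense appropriate to square integrable derivatives: each `K^{x,y}` is
continuous, each `Σ^{x,y}(s,t)` is a covariance matrix, and the integral equation holds. -/
structure IsNeuralSigKernel {d : ℕ} (φ : ℝ → ℝ) (σa σA σb : ℝ)
    (K : PathSpace d → PathSpace d → ℝ → ℝ → ℝ) : Prop where
  continuousOn : ∀ x y : PathSpace d,
    ContinuousOn (fun p : ℝ × ℝ => K x y p.1 p.2) (Set.Icc 0 1 ×ˢ Set.Icc 0 1)
  posSemidef : ∀ x y : PathSpace d, ∀ s ∈ Set.Icc (0 : ℝ) 1, ∀ t ∈ Set.Icc (0 : ℝ) 1,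
    (covMat K x y s t).PosSemidef
  equation : ∀ x y : PathSpace d, ∀ s ∈ Set.Icc (0 : ℝ) 1, ∀ t ∈ Set.Icc (0 : ℝ) 1,
    K x y s t = σa ^ 2 + ∫ η in (0 : ℝ)..s, ∫ τ in (0 : ℝ)..t,
      (σA ^ 2 * gaussV φ (covMat K x y η τ) + σb ^ 2) * ⟪dot x η, dot y τ⟫

/-- The neural signature kernel `𝒦_φ^{x,y}(s,t)`: the solution, when there is one, of the defining
equation (only its values for `s, t ∈ [0,1]` are meaningful). -/
noncomputable def neuralSigKernel {d : ℕ} (φ : ℝ → ℝ) (σa σA σb : ℝ) :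
    PathSpace d → PathSpace d → ℝ → ℝ → ℝ :=
  Classical.epsilon fun K => IsNeuralSigKernel φ σa σA σb K

end NeuralSig

namespace NeuralSig

/-! ### Square integrable derivatives -/

/-! For a centred Gaussian vector, `E[Z₁ Z₂]` is the off-diagonal covariance. With `φ = id` the
system therefore decouples into one linear equation per pair: `K = σa² + ∬ (σA² K + σb²)⟪ẋ, ẏ⟫`.
Adding `σb²/σA²` to `K` absorbs the source term and leaves the equation `k = k₀ + ∬ k ⟪σA ẋ, σA ẏ⟫`
with `k₀ = σa² + σb²/σA²`.

The signature kernel solves this with `k₀ = 1`. Inner products of elementary tensors factor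
(`inner_snocTensor`), so the level `n + 1` term is the double integral of the level `n` term, and
factorial decay (`norm_sigLevel_le`) allows summing under the integral. Uniqueness is Picard
iteration with the same decay (`eq_zero_of_eq_integral`). Membership in the class still needs
positive semidefiniteness despite the subtracted constant; the empty word supplies it
(`sq_add_le_sigKernel_form`). -/

theorem IsL2Deriv.ae_eq {d : ℕ} {x : C(I, EuclideanSpace ℝ (Fin d))}
    {v w : ℝ → EuclideanSpace ℝ (Fin d)} (hv : IsL2Deriv x v) (hw : IsL2Deriv x w) :
    v =ᵐ[volume.restrict (Set.Ioc 0 1)] w := by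
  have hd1 := (hv.intervalIntegrable 1).ae_hasDerivAt_integral
  have hd2 := (hw.intervalIntegrable 1).ae_hasDerivAt_integral
  -- Dropping the endpoint leaves points with a full neighbourhood in `[0,1]`, where both primitives
  -- equal `x` and Lebesgue differentiation applies.
  rw [← Measure.restrict_congr_set Ioo_ae_eq_Ioc]
  refine (ae_restrict_iff' measurableSet_Ioo).2 ?_
  filter_upwards [hd1, hd2] with u h1 h2 hu
  have huI : u ∈ Set.uIcc (0 : ℝ) ((1 : I) : ℝ) := by
    rw [Set.uIcc_of_le (by simp)]; exact ⟨hu.1.le, hu.2.le⟩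
  have h0 : (0 : ℝ) ∈ Set.uIcc (0 : ℝ) ((1 : I) : ℝ) := Set.left_mem_uIcc
  refine (h1 huI 0 h0).unique ((h2 huI 0 h0).congr_of_eventuallyEq ?_)
  filter_upwards [Ioo_mem_nhds hu.1 hu.2] with t ht
  exact (hv.2 ⟨t, ht.1.le, ht.2.le⟩).symm.trans (hw.2 ⟨t, ht.1.le, ht.2.le⟩)

/-- `dot` is a chosen representative, so it commutes with scaling only almost everywhere. -/
theorem dot_smul_ae_eq {d : ℕ} (c : ℝ) (x : PathSpace d) :
    dot (c • x) =ᵐ[volume.restrict (Set.Ioc 0 1)] fun u => c • dot x u := by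
  have hx := isL2Deriv_dot x
  refine (isL2Deriv_dot (c • x)).ae_eq ⟨hx.1.const_smul c, fun t => ?_⟩
  rw [intervalIntegral.integral_smul, ← hx.2 t]
  rfl

theorem integrableOn_dot {d : ℕ} (x : PathSpace d) :
    IntegrableOn (dot x) (Set.Icc (0 : ℝ) 1) volume :=
  (isL2Deriv_dot x).1.integrable (by norm_num)

/-! ### The dual activation of the identity -/

theorem gaussV_id {S : Matrix (Fin 2) (Fin 2) ℝ} (hS : S.PosSemidef) : gaussV id S = S 0 1 := by
  have hm (i : Fin 2) : MemLp (fun z : EuclideanSpace ℝ (Fin 2) => z i) 2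
      (multivariateGaussian 0 S) :=
    (IsGaussian.memLp_two_id (μ := multivariateGaussian (0 : EuclideanSpace ℝ (Fin 2)) S)).eval_piLp i
  have h0 (i : Fin 2) : ∫ z, z i ∂(multivariateGaussian (0 : EuclideanSpace ℝ (Fin 2)) S) = 0 := by
    have h := (EuclideanSpace.proj (𝕜 := ℝ) i).integral_comp_comm
      (IsGaussian.integrable_id (μ := multivariateGaussian (0 : EuclideanSpace ℝ (Fin 2)) S))
    simpa using h
  have hc := covariance_eval_multivariateGaussian (μ := 0) hS 0 1
  rw [covariance_eq_sub (hm 0) (hm 1), h0 0, h0 1, mul_zero, sub_zero] at hc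
  exact hc

/-! ### Signature levels as iterated integrals of tensors -/

/-- The tensor product `a ⊗ v` in coordinates. -/
noncomputable def snocTensor {d n : ℕ} (a : EuclideanSpace ℝ (Fin n → Fin d))
    (v : EuclideanSpace ℝ (Fin d)) : EuclideanSpace ℝ (Fin (n + 1) → Fin d) :=
  WithLp.toLp 2 fun w => a (Fin.init w) * v (w (Fin.last n))

/-- Splitting a word into its initial part and last letter turns the sum over words into a product
of sums. -/
theorem inner_snocTensor {d n : ℕ} (a b : EuclideanSpace ℝ (Fin n → Fin d))
    (v w : EuclideanSpace ℝ (Fin d)) :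
    ⟪snocTensor a v, snocTensor b w⟫ = ⟪a, b⟫ * ⟪v, w⟫ := by
  simp only [PiLp.inner_apply, snocTensor, Finset.sum_mul_sum, ← Finset.sum_product',
    Finset.univ_product_univ]
  refine Fintype.sum_equiv ((Fin.snocEquiv fun _ : Fin (n + 1) => Fin d).symm.trans
    (Equiv.prodComm _ _)) _ _ fun p => ?_
  simp [Fin.snocEquiv]
  ring

theorem norm_snocTensor {d n : ℕ} (a : EuclideanSpace ℝ (Fin n → Fin d))
    (v : EuclideanSpace ℝ (Fin d)) : ‖snocTensor a v‖ = ‖a‖ * ‖v‖ := by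
  rw [← sq_eq_sq₀ (norm_nonneg _) (by positivity), ← real_inner_self_eq_norm_sq,
    inner_snocTensor, real_inner_self_eq_norm_sq, real_inner_self_eq_norm_sq, mul_pow]

theorem continuous_snocTensor {d n : ℕ} :
    Continuous fun p : EuclideanSpace ℝ (Fin n → Fin d) × EuclideanSpace ℝ (Fin d) =>
      snocTensor p.1 p.2 := by
  unfold snocTensor
  fun_prop

theorem integrableOn_snocTensor {d n : ℕ} (x : PathSpace d)
    {f : ℝ → EuclideanSpace ℝ (Fin n → Fin d)} (hf : ContinuousOn f (Set.Icc 0 1)) :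
    IntegrableOn (fun u => snocTensor (f u) (dot x u)) (Set.Icc 0 1) := by
  have hm := (hf.aestronglyMeasurable measurableSet_Icc).prodMk
    (integrableOn_dot x).aestronglyMeasurable
  have hi : IntegrableOn (fun u => ‖f u‖ * ‖dot x u‖) (Set.Icc 0 1) :=
    IntegrableOn.continuousOn_mul hf.norm (integrableOn_dot x).norm isCompact_Icc
  refine Integrable.mono hi (continuous_snocTensor.comp_aestronglyMeasurable hm) (ae_of_all _ fun u => ?_)
  simp [norm_snocTensor]

/-- Integrability is a hypothesis because it comes from continuity of level `n`, whose inductive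
proof uses this very identity. -/
theorem sigLevel_succ_eq_of_integrableOn {d n : ℕ} (x : PathSpace d)
    (h : IntegrableOn (fun u => snocTensor (sigLevel x n u) (dot x u)) (Set.Icc 0 1))
    {t : ℝ} (ht : t ∈ Set.Icc (0 : ℝ) 1) :
    sigLevel x (n + 1) t = ∫ u in (0 : ℝ)..t, snocTensor (sigLevel x n u) (dot x u) := by
  have hi : IntervalIntegrable (fun u => snocTensor (sigLevel x n u) (dot x u)) volume 0 t := by
    rw [intervalIntegrable_iff_integrableOn_Icc_of_le ht.1]
    exact h.mono_set (Set.Icc_subset_Icc_right ht.2)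
  ext w
  have := (EuclideanSpace.proj (𝕜 := ℝ) w).intervalIntegral_comp_comm hi
  simpa [sigLevel, snocTensor] using this

theorem continuousOn_sigLevel {d : ℕ} (x : PathSpace d) (n : ℕ) :
    ContinuousOn (sigLevel x n) (Set.Icc 0 1) := by
  induction n with
  | zero => exact continuousOn_const
  | succ n ih =>
    have h := integrableOn_snocTensor x ih
    have hc := intervalIntegral.continuousOn_primitive_interval (a := 0) (b := 1)
      (by rwa [Set.uIcc_of_le zero_le_one])
    rw [Set.uIcc_of_le zero_le_one] at hc
    exact hc.congr fun t ht => sigLevel_succ_eq_of_integrableOn x h ht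

theorem sigLevel_succ {d : ℕ} (x : PathSpace d) (n : ℕ) {t : ℝ} (ht : t ∈ Set.Icc (0 : ℝ) 1) :
    sigLevel x (n + 1) t = ∫ u in (0 : ℝ)..t, snocTensor (sigLevel x n u) (dot x u) :=
  sigLevel_succ_eq_of_integrableOn x (integrableOn_snocTensor x (continuousOn_sigLevel x n)) ht

/-! ### Factorial decay -/

/-- The energy `∫₀¹ ‖ẋ‖²` of a path. -/
noncomputable def energy {d : ℕ} (x : PathSpace d) : ℝ := ∫ u in (0 : ℝ)..1, ‖dot x u‖ ^ 2

theorem energy_nonneg {d : ℕ} (x : PathSpace d) : 0 ≤ energy x :=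
  intervalIntegral.integral_nonneg zero_le_one fun _ _ => by positivity

/-- Cauchy–Schwarz: one factor integrates to `Eⁿ sⁿ⁺¹/(n+1)!`, the other is at most `E`, where `E =
energy x`. This family of bounds, stable under integration against `‖ẋ‖`, drives both the decay of
the signature and uniqueness. -/
theorem integral_sqrt_mul_norm_dot_le {d : ℕ} (x : PathSpace d) (n : ℕ) {s : ℝ}
    (hs : s ∈ Set.Icc (0 : ℝ) 1) :
    ∫ u in (0 : ℝ)..s, √((energy x * u) ^ n / n.factorial) * ‖dot x u‖ ≤
      √((energy x * s) ^ (n + 1) / (n + 1).factorial) := by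
  have hE := energy_nonneg x
  have hsub : Set.Ioc (0 : ℝ) s ⊆ Set.Icc 0 1 := fun u hu => ⟨hu.1.le, hu.2.trans hs.2⟩
  have hv : MemLp (fun u => ‖dot x u‖) (ENNReal.ofReal 2) (volume.restrict (Set.Ioc 0 s)) := by
    simpa using ((isL2Deriv_dot x).1.mono_measure (Measure.restrict_mono_set _ hsub)).norm
  have hsq : IntervalIntegrable (fun u => ‖dot x u‖ ^ 2) volume 0 1 := by
    rw [intervalIntegrable_iff_integrableOn_Icc_of_le zero_le_one]
    exact (isL2Deriv_dot x).1.norm.integrable_sq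
  have hf : MemLp (fun u : ℝ => √((energy x * u) ^ n / n.factorial)) (ENNReal.ofReal 2)
      (volume.restrict (Set.Ioc 0 s)) := by
    have hc : Continuous fun u : ℝ => √((energy x * u) ^ n / n.factorial) := by fun_prop
    rw [ENNReal.ofReal_ofNat, memLp_two_iff_integrable_sq hc.aestronglyMeasurable]
    exact ((hc.pow 2).integrableOn_Icc).mono_set Set.Ioc_subset_Icc_self
  have key := integral_mul_le_Lp_mul_Lq_of_nonneg Real.HolderConjugate.two_two
    (ae_of_all _ fun u => Real.sqrt_nonneg _) (ae_of_all _ fun u => norm_nonneg _) hf hv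
  rw [intervalIntegral.integral_of_le hs.1]
  refine key.trans ?_
  simp only [Real.rpow_two, ← Real.sqrt_eq_rpow]
  rw [← intervalIntegral.integral_of_le hs.1, ← intervalIntegral.integral_of_le hs.1,
    ← Real.sqrt_mul' _ (intervalIntegral.integral_nonneg hs.1 fun _ _ => by positivity)]
  refine Real.sqrt_le_sqrt ?_
  have h1 : ∫ u in (0 : ℝ)..s, √((energy x * u) ^ n / n.factorial) ^ 2 =
      energy x ^ n * s ^ (n + 1) / (n + 1).factorial := by
    have : ∀ u ∈ Set.uIcc (0 : ℝ) s, √((energy x * u) ^ n / n.factorial) ^ 2 =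
        energy x ^ n / n.factorial * u ^ n := by
      intro u hu
      rw [Set.uIcc_of_le hs.1] at hu
      have := hu.1
      rw [Real.sq_sqrt (by positivity)]
      ring
    rw [intervalIntegral.integral_congr this, intervalIntegral.integral_const_mul, integral_pow,
      Nat.factorial_succ]
    push_cast
    field_simp
    simp
  have h2 : ∫ u in (0 : ℝ)..s, ‖dot x u‖ ^ 2 ≤ energy x :=
    intervalIntegral.integral_mono_interval le_rfl hs.1 hs.2
      (ae_of_all _ fun u => by positivity) hsq
  have h3 : 0 ≤ s := hs.1
  rw [h1]
  calc _ ≤ energy x ^ n * s ^ (n + 1) / (n + 1).factorial * energy x := by gcongr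
    _ = _ := by ring

theorem norm_sigLevel_le {d : ℕ} (x : PathSpace d) (n : ℕ) {s : ℝ}
    (hs : s ∈ Set.Icc (0 : ℝ) 1) :
    ‖sigLevel x n s‖ ≤ √((energy x * s) ^ n / n.factorial) := by
  induction n generalizing s with
  | zero => simp [sigLevel, EuclideanSpace.norm_eq]
  | succ n ih =>
    rw [sigLevel_succ x n hs]
    refine le_trans ?_ (integral_sqrt_mul_norm_dot_le x n hs)
    refine intervalIntegral.norm_integral_le_of_norm_le hs.1 (ae_of_all _ fun u hu => ?_) ?_
    · rw [norm_snocTensor]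
      exact mul_le_mul_of_nonneg_right (ih ⟨hu.1.le, hu.2.trans hs.2⟩) (norm_nonneg _)
    · rw [intervalIntegrable_iff_integrableOn_Icc_of_le hs.1]
      exact IntegrableOn.continuousOn_mul (by fun_prop)
        (IntegrableOn.mono_set (integrableOn_dot x).norm (Set.Icc_subset_Icc_right hs.2))
        isCompact_Icc

/-! ### Double integrals against `⟪ẋ, ẏ⟫` -/

theorem integrableOn_dot_Ioc {d : ℕ} (x : PathSpace d) {s : ℝ} (hs : s ∈ Set.Icc (0 : ℝ) 1) :
    IntegrableOn (dot x) (Set.Ioc 0 s) :=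
  (integrableOn_dot x).mono_set fun _ hu => ⟨hu.1.le, hu.2.trans hs.2⟩

theorem integrable_mul_inner_dot {d : ℕ} (x y : PathSpace d) {F : ℝ → ℝ → ℝ}
    (hF : ContinuousOn (fun p : ℝ × ℝ => F p.1 p.2) (Set.Icc 0 1 ×ˢ Set.Icc 0 1)) {s t : ℝ}
    (hs : s ∈ Set.Icc (0 : ℝ) 1) (ht : t ∈ Set.Icc (0 : ℝ) 1) :
    Integrable (fun p : ℝ × ℝ => F p.1 p.2 * ⟪dot x p.1, dot y p.2⟫)
      ((volume.restrict (Set.Ioc 0 s)).prod (volume.restrict (Set.Ioc 0 t))) := by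
  have hsub : Set.Ioc 0 s ×ˢ Set.Ioc 0 t ⊆ Set.Icc (0 : ℝ) 1 ×ˢ Set.Icc (0 : ℝ) 1 :=
    fun p hp => ⟨⟨hp.1.1.le, hp.1.2.trans hs.2⟩, ⟨hp.2.1.le, hp.2.2.trans ht.2⟩⟩
  obtain ⟨C, hC⟩ := (isCompact_Icc.prod isCompact_Icc).exists_bound_of_continuousOn hF
  have hx := integrableOn_dot_Ioc x hs
  have hy := integrableOn_dot_Ioc y ht
  have hFm : AEStronglyMeasurable (fun p : ℝ × ℝ => F p.1 p.2)
      ((volume.restrict (Set.Ioc 0 s)).prod (volume.restrict (Set.Ioc 0 t))) := by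
    rw [Measure.prod_restrict]
    exact (hF.mono hsub).aestronglyMeasurable (measurableSet_Ioc.prod measurableSet_Ioc)
  have hm := hFm.mul (hx.aestronglyMeasurable.comp_fst.inner (𝕜 := ℝ)
    hy.aestronglyMeasurable.comp_snd)
  refine ((hx.norm.mul_prod hy.norm).const_mul C).mono' hm ?_
  rw [Measure.prod_restrict]
  filter_upwards [ae_restrict_mem (measurableSet_Ioc.prod measurableSet_Ioc)] with p hp
  rw [norm_mul]
  exact mul_le_mul (hC p (hsub hp)) (norm_inner_le_norm _ _) (norm_nonneg _)
    ((norm_nonneg _).trans (hC p (hsub hp)))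

theorem integral_integral_mul_inner_dot {d : ℕ} (x y : PathSpace d) {F : ℝ → ℝ → ℝ}
    (hF : ContinuousOn (fun p : ℝ × ℝ => F p.1 p.2) (Set.Icc 0 1 ×ˢ Set.Icc 0 1)) {s t : ℝ}
    (hs : s ∈ Set.Icc (0 : ℝ) 1) (ht : t ∈ Set.Icc (0 : ℝ) 1) :
    ∫ η in (0 : ℝ)..s, ∫ τ in (0 : ℝ)..t, F η τ * ⟪dot x η, dot y τ⟫ =
      ∫ p, F p.1 p.2 * ⟪dot x p.1, dot y p.2⟫
        ∂((volume.restrict (Set.Ioc 0 s)).prod (volume.restrict (Set.Ioc 0 t))) := by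
  rw [integral_prod _ (integrable_mul_inner_dot x y hF hs ht),
    intervalIntegral.integral_of_le hs.1]
  simp_rw [intervalIntegral.integral_of_le ht.1]

/-! ### The signature kernel -/

theorem norm_sigLevel_sq_le {d : ℕ} (x : PathSpace d) (n : ℕ) {s : ℝ}
    (hs : s ∈ Set.Icc (0 : ℝ) 1) :
    ‖sigLevel x n s‖ ^ 2 ≤ energy x ^ n / n.factorial := by
  have hE := energy_nonneg x
  have hs0 := hs.1
  refine (pow_le_pow_left₀ (norm_nonneg _) (norm_sigLevel_le x n hs) 2).trans ?_
  rw [Real.sq_sqrt (by positivity)]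
  gcongr
  exact mul_le_of_le_one_right hE hs.2

/-- A sum in place of the Cauchy–Schwarz product makes the majorant two exponential series, uniform
in `s` and `t`. -/
theorem norm_inner_sigLevel_le {d : ℕ} (x y : PathSpace d) (n : ℕ) {s t : ℝ}
    (hs : s ∈ Set.Icc (0 : ℝ) 1) (ht : t ∈ Set.Icc (0 : ℝ) 1) :
    ‖⟪sigLevel x n s, sigLevel y n t⟫‖ ≤
      energy x ^ n / n.factorial + energy y ^ n / n.factorial := by
  have h := norm_inner_le_norm (𝕜 := ℝ) (sigLevel x n s) (sigLevel y n t)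
  nlinarith [norm_sigLevel_sq_le x n hs, norm_sigLevel_sq_le y n ht,
    sq_nonneg (‖sigLevel x n s‖ - ‖sigLevel y n t‖), sq_nonneg ‖sigLevel x n s‖,
    sq_nonneg ‖sigLevel y n t‖]

theorem summable_energy {d : ℕ} (x y : PathSpace d) :
    Summable fun n : ℕ => energy x ^ n / n.factorial + energy y ^ n / n.factorial :=
  (Real.summable_pow_div_factorial _).add (Real.summable_pow_div_factorial _)

theorem summable_inner_sigLevel {d : ℕ} (x y : PathSpace d) {s t : ℝ}
    (hs : s ∈ Set.Icc (0 : ℝ) 1) (ht : t ∈ Set.Icc (0 : ℝ) 1) :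
    Summable fun n : ℕ => ⟪sigLevel x n s, sigLevel y n t⟫ :=
  (summable_energy x y).of_norm_bounded fun n => norm_inner_sigLevel_le x y n hs ht

theorem continuousOn_inner_sigLevel {d : ℕ} (x y : PathSpace d) (n : ℕ) :
    ContinuousOn (fun p : ℝ × ℝ => ⟪sigLevel x n p.1, sigLevel y n p.2⟫)
      (Set.Icc 0 1 ×ˢ Set.Icc 0 1) :=
  ContinuousOn.inner (𝕜 := ℝ)
    ((continuousOn_sigLevel x n).comp continuousOn_fst fun _ hp => (Set.mem_prod.1 hp).1)
    ((continuousOn_sigLevel y n).comp continuousOn_snd fun _ hp => (Set.mem_prod.1 hp).2)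

theorem continuousOn_sigKernel {d : ℕ} (x y : PathSpace d) :
    ContinuousOn (fun p : ℝ × ℝ => sigKernel x y p.1 p.2) (Set.Icc 0 1 ×ˢ Set.Icc 0 1) :=
  continuousOn_tsum (continuousOn_inner_sigLevel x y) (summable_energy x y)
    fun n _ hp => norm_inner_sigLevel_le x y n hp.1 hp.2

theorem inner_sigLevel_succ {d : ℕ} (x y : PathSpace d) (n : ℕ) {s t : ℝ}
    (hs : s ∈ Set.Icc (0 : ℝ) 1) (ht : t ∈ Set.Icc (0 : ℝ) 1) :
    ⟪sigLevel x (n + 1) s, sigLevel y (n + 1) t⟫ =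
      ∫ η in (0 : ℝ)..s, ∫ τ in (0 : ℝ)..t,
        ⟪sigLevel x n η, sigLevel y n τ⟫ * ⟪dot x η, dot y τ⟫ := by
  have hi (z : PathSpace d) {r : ℝ} (hr : r ∈ Set.Icc (0 : ℝ) 1) :
      IntegrableOn (fun u => snocTensor (sigLevel z n u) (dot z u)) (Set.Ioc 0 r) :=
    (integrableOn_snocTensor z (continuousOn_sigLevel z n)).mono_set
      fun _ hu => ⟨hu.1.le, hu.2.trans hr.2⟩
  simp_rw [← inner_snocTensor]
  have hin (a : EuclideanSpace ℝ (Fin (n + 1) → Fin d)) :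
      ∫ τ in (0 : ℝ)..t, ⟪a, snocTensor (sigLevel y n τ) (dot y τ)⟫ =
        ⟪a, sigLevel y (n + 1) t⟫ := by
    rw [sigLevel_succ y n ht, intervalIntegral.integral_of_le ht.1,
      intervalIntegral.integral_of_le ht.1]
    exact integral_inner (𝕜 := ℝ) (hi y ht) a
  simp_rw [hin, real_inner_comm (sigLevel y (n + 1) t)]
  rw [sigLevel_succ x n hs, intervalIntegral.integral_of_le hs.1,
    intervalIntegral.integral_of_le hs.1]
  exact (integral_inner (𝕜 := ℝ) (hi x hs) _).symm

theorem sigKernel_eq_one_add_integral {d : ℕ} (x y : PathSpace d) {s t : ℝ}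
    (hs : s ∈ Set.Icc (0 : ℝ) 1) (ht : t ∈ Set.Icc (0 : ℝ) 1) :
    sigKernel x y s t = 1 + ∫ η in (0 : ℝ)..s, ∫ τ in (0 : ℝ)..t,
      sigKernel x y η τ * ⟪dot x η, dot y τ⟫ := by
  have hsub : Set.Ioc 0 s ×ˢ Set.Ioc 0 t ⊆ Set.Icc (0 : ℝ) 1 ×ˢ Set.Icc (0 : ℝ) 1 :=
    fun p hp => ⟨⟨hp.1.1.le, hp.1.2.trans hs.2⟩, ⟨hp.2.1.le, hp.2.2.trans ht.2⟩⟩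
  have hmem : ∀ᵐ p ∂((volume.restrict (Set.Ioc 0 s)).prod (volume.restrict (Set.Ioc 0 t))),
      p ∈ Set.Icc (0 : ℝ) 1 ×ˢ Set.Icc (0 : ℝ) 1 := by
    rw [Measure.prod_restrict]
    exact (ae_restrict_mem (measurableSet_Ioc.prod measurableSet_Ioc)).mono fun p hp => hsub hp
  have hsum := hasSum_integral_of_dominated_convergence
    (μ := (volume.restrict (Set.Ioc 0 s)).prod (volume.restrict (Set.Ioc 0 t)))
    (F := fun n p => ⟪sigLevel x n p.1, sigLevel y n p.2⟫ * ⟪dot x p.1, dot y p.2⟫)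
    (f := fun p => sigKernel x y p.1 p.2 * ⟪dot x p.1, dot y p.2⟫)
    (fun n p => (energy x ^ n / n.factorial + energy y ^ n / n.factorial) *
      (‖dot x p.1‖ * ‖dot y p.2‖))
    (fun n => (integrable_mul_inner_dot x y (F := fun η τ => ⟪sigLevel x n η, sigLevel y n τ⟫)
      (continuousOn_inner_sigLevel x y n) hs ht).aestronglyMeasurable)
    (fun n => hmem.mono fun p hp => by
      rw [norm_mul]
      have h1 := norm_inner_sigLevel_le x y n hp.1 hp.2
      exact mul_le_mul h1 (norm_inner_le_norm _ _) (norm_nonneg _) ((norm_nonneg _).trans h1))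
    (ae_of_all _ fun p => (summable_energy x y).mul_right _)
    (by
      simp_rw [tsum_mul_right]
      exact ((integrableOn_dot_Ioc x hs).norm.mul_prod (integrableOn_dot_Ioc y ht).norm).const_mul _)
    (hmem.mono fun p hp => (summable_inner_sigLevel x y hp.1 hp.2).hasSum.mul_right _)
  rw [integral_integral_mul_inner_dot x y (continuousOn_sigKernel x y) hs ht, ← hsum.tsum_eq,
    sigKernel, (summable_inner_sigLevel x y hs ht).tsum_eq_zero_add]
  congr 1
  · simp [sigLevel, EuclideanSpace.norm_eq]
  · refine tsum_congr fun n => ?_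
    rw [inner_sigLevel_succ x y n hs ht]
    exact integral_integral_mul_inner_dot x y (F := fun η τ => ⟪sigLevel x n η, sigLevel y n τ⟫)
      (continuousOn_inner_sigLevel x y n) hs ht

/-- The Gram form of the signatures dominates its contribution from the empty word. -/
theorem sq_add_le_sigKernel_form {d : ℕ} (x y : PathSpace d) {s t : ℝ}
    (hs : s ∈ Set.Icc (0 : ℝ) 1) (ht : t ∈ Set.Icc (0 : ℝ) 1) (a b : ℝ) :
    (a + b) ^ 2 ≤ a ^ 2 * sigKernel x x s s + 2 * a * b * sigKernel x y s t +
      b ^ 2 * sigKernel y y t t := by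
  -- The form is the squared norm of `a Sig(x) + b Sig(y)`, summed level by level; level `0` alone
  -- contributes `(a + b)²`.
  have h : HasSum (fun n => ‖a • sigLevel x n s + b • sigLevel y n t‖ ^ 2)
      (a ^ 2 * sigKernel x x s s + 2 * a * b * sigKernel x y s t + b ^ 2 * sigKernel y y t t) := by
    have := (((summable_inner_sigLevel x x hs hs).hasSum.mul_left (a ^ 2)).add
      ((summable_inner_sigLevel x y hs ht).hasSum.mul_left (2 * a * b))).add
      ((summable_inner_sigLevel y y ht ht).hasSum.mul_left (b ^ 2))
    refine this.congr_fun fun n => ?_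
    rw [norm_add_sq_real, norm_smul, norm_smul, mul_pow, mul_pow, Real.norm_eq_abs,
      Real.norm_eq_abs, sq_abs, sq_abs, real_inner_self_eq_norm_sq, real_inner_self_eq_norm_sq,
      real_inner_smul_left, real_inner_smul_right]
    ring
  have h0 := le_hasSum h 0 fun n _ => sq_nonneg _
  refine le_trans (le_of_eq ?_) h0
  rw [EuclideanSpace.norm_sq_eq]
  simp [sigLevel]

/-! ### Uniqueness for the linear Goursat problem -/

/-- Only the first variable needs to gain a factorial; the second is bounded crudely by the `L¹`
norm of `ẏ`, whose powers the factorial beats. -/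
theorem norm_integral_mul_inner_dot_le {d : ℕ} (x y : PathSpace d) {F : ℝ → ℝ → ℝ} {M : ℝ} {n : ℕ}
    (hF : ∀ η ∈ Set.Icc (0 : ℝ) 1, ∀ τ ∈ Set.Icc (0 : ℝ) 1,
      ‖F η τ‖ ≤ M * √((energy x * η) ^ n / n.factorial))
    {s t : ℝ} (hs : s ∈ Set.Icc (0 : ℝ) 1) (ht : t ∈ Set.Icc (0 : ℝ) 1) (hM : 0 ≤ M) :
    ‖∫ p, F p.1 p.2 * ⟪dot x p.1, dot y p.2⟫
        ∂((volume.restrict (Set.Ioc 0 s)).prod (volume.restrict (Set.Ioc 0 t)))‖ ≤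
      M * (∫ τ in (0 : ℝ)..1, ‖dot y τ‖) *
        √((energy x * s) ^ (n + 1) / (n + 1).factorial) := by
  have hx : IntegrableOn (fun η => √((energy x * η) ^ n / n.factorial) * ‖dot x η‖)
      (Set.Ioc 0 s) :=
    IntegrableOn.mono_set (IntegrableOn.continuousOn_mul (by fun_prop)
      (integrableOn_dot x).norm isCompact_Icc) fun _ hu => ⟨hu.1.le, hu.2.trans hs.2⟩
  have hy := (integrableOn_dot_Ioc y ht).norm
  calc _ ≤ ∫ p, M * ((√((energy x * p.1) ^ n / n.factorial) * ‖dot x p.1‖) * ‖dot y p.2‖)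
        ∂((volume.restrict (Set.Ioc 0 s)).prod (volume.restrict (Set.Ioc 0 t))) := by
        refine norm_integral_le_of_norm_le ((hx.mul_prod hy).const_mul M) ?_
        rw [Measure.prod_restrict]
        filter_upwards [ae_restrict_mem (measurableSet_Ioc.prod measurableSet_Ioc)] with p hp
        have h1 := hF p.1 ⟨hp.1.1.le, hp.1.2.trans hs.2⟩ p.2 ⟨hp.2.1.le, hp.2.2.trans ht.2⟩
        rw [norm_mul]
        calc _ ≤ M * √((energy x * p.1) ^ n / n.factorial) * (‖dot x p.1‖ * ‖dot y p.2‖) :=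
              mul_le_mul h1 (norm_inner_le_norm _ _) (norm_nonneg _) ((norm_nonneg _).trans h1)
          _ = _ := by ring
    _ = M * ((∫ η in (0 : ℝ)..s, √((energy x * η) ^ n / n.factorial) * ‖dot x η‖) *
          ∫ τ in (0 : ℝ)..t, ‖dot y τ‖) := by
        rw [integral_const_mul, intervalIntegral.integral_of_le hs.1,
          intervalIntegral.integral_of_le ht.1]
        congr 1
        exact integral_prod_mul (fun η => √((energy x * η) ^ n / n.factorial) * ‖dot x η‖)
          fun τ => ‖dot y τ‖
    _ ≤ M * (√((energy x * s) ^ (n + 1) / (n + 1).factorial) *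
          ∫ τ in (0 : ℝ)..1, ‖dot y τ‖) := by
        have h2 := integral_sqrt_mul_norm_dot_le x n hs
        have h3 : ∫ τ in (0 : ℝ)..t, ‖dot y τ‖ ≤ ∫ τ in (0 : ℝ)..1, ‖dot y τ‖ :=
          intervalIntegral.integral_mono_interval le_rfl ht.1 ht.2
            (ae_of_all _ fun u => norm_nonneg _) <| by
              rw [intervalIntegrable_iff_integrableOn_Icc_of_le zero_le_one]
              exact (integrableOn_dot y).norm
        have h4 : 0 ≤ ∫ τ in (0 : ℝ)..t, ‖dot y τ‖ :=
          intervalIntegral.integral_nonneg ht.1 fun _ _ => norm_nonneg _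
        gcongr
    _ = _ := by ring

/-- A continuous solution of the homogeneous integral equation vanishes. -/
theorem eq_zero_of_eq_integral {d : ℕ} (x y : PathSpace d) (c : ℝ) {D : ℝ → ℝ → ℝ}
    (hD : ContinuousOn (fun p : ℝ × ℝ => D p.1 p.2) (Set.Icc 0 1 ×ˢ Set.Icc 0 1))
    (heq : ∀ s ∈ Set.Icc (0 : ℝ) 1, ∀ t ∈ Set.Icc (0 : ℝ) 1,
      D s t = c * ∫ p, D p.1 p.2 * ⟪dot x p.1, dot y p.2⟫
        ∂((volume.restrict (Set.Ioc 0 s)).prod (volume.restrict (Set.Ioc 0 t))))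
    {s t : ℝ} (hs : s ∈ Set.Icc (0 : ℝ) 1) (ht : t ∈ Set.Icc (0 : ℝ) 1) : D s t = 0 := by
  obtain ⟨C, hC⟩ := (isCompact_Icc.prod isCompact_Icc).exists_bound_of_continuousOn hD
  have hC0 : 0 ≤ C := (norm_nonneg _).trans (hC (s, t) ⟨hs, ht⟩)
  set r : ℝ := |c| * ∫ τ in (0 : ℝ)..1, ‖dot y τ‖
  have hr : 0 ≤ r := mul_nonneg (abs_nonneg _)
    (intervalIntegral.integral_nonneg zero_le_one fun _ _ => norm_nonneg _)
  have hbound (n : ℕ) : ∀ η ∈ Set.Icc (0 : ℝ) 1, ∀ τ ∈ Set.Icc (0 : ℝ) 1,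
      ‖D η τ‖ ≤ C * r ^ n * √((energy x * η) ^ n / n.factorial) := by
    induction n with
    | zero =>
      intro η hη τ hτ
      simpa using hC (η, τ) ⟨hη, hτ⟩
    | succ n ih =>
      intro η hη τ hτ
      rw [heq η hη τ hτ, norm_mul, Real.norm_eq_abs c]
      refine (mul_le_mul_of_nonneg_left
        (norm_integral_mul_inner_dot_le x y ih hη hτ (by positivity)) (abs_nonneg c)).trans_eq ?_
      simp only [r]
      ring
  -- Under the root `rⁿ` becomes `(r²)ⁿ`, leaving the root of an exponential series term.
  have hlim : Filter.Tendsto (fun n : ℕ => C * √((r ^ 2 * (energy x * s)) ^ n / n.factorial))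
      Filter.atTop (nhds 0) := by
    simpa using ((FloorSemiring.tendsto_pow_div_factorial_atTop _).sqrt).const_mul C
  refine norm_le_zero_iff.1 (ge_of_tendsto' hlim fun n => (hbound n s hs t ht).trans_eq ?_)
  have hpow : (r ^ 2 * (energy x * s)) ^ n / n.factorial =
      (r ^ n) ^ 2 * ((energy x * s) ^ n / n.factorial) := by ring
  rw [hpow, Real.sqrt_mul (sq_nonneg _), Real.sqrt_sq (by positivity), mul_assoc]

/-! ### The equation for the identity activation -/

theorem integral_gaussV_id {d : ℕ} {σA σb : ℝ} {K : PathSpace d → PathSpace d → ℝ → ℝ → ℝ}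
    (hK : ∀ x y : PathSpace d, ∀ s ∈ Set.Icc (0 : ℝ) 1, ∀ t ∈ Set.Icc (0 : ℝ) 1,
      (covMat K x y s t).PosSemidef) (x y : PathSpace d) {s t : ℝ}
    (hs : s ∈ Set.Icc (0 : ℝ) 1) (ht : t ∈ Set.Icc (0 : ℝ) 1) :
    ∫ η in (0 : ℝ)..s, ∫ τ in (0 : ℝ)..t,
        (σA ^ 2 * gaussV id (covMat K x y η τ) + σb ^ 2) * ⟪dot x η, dot y τ⟫ =
      ∫ η in (0 : ℝ)..s, ∫ τ in (0 : ℝ)..t,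
        (σA ^ 2 * K x y η τ + σb ^ 2) * ⟪dot x η, dot y τ⟫ := by
  refine intervalIntegral.integral_congr fun η hη => intervalIntegral.integral_congr fun τ hτ => ?_
  rw [Set.uIcc_of_le hs.1] at hη
  rw [Set.uIcc_of_le ht.1] at hτ
  rw [gaussV_id (hK x y η ⟨hη.1, hη.2.trans hs.2⟩ τ ⟨hτ.1, hτ.2.trans ht.2⟩)]
  simp [covMat]

/-- The affine terms cancel in `K - L`, which solves the homogeneous equation with constant `σA²`.
-/
theorem IsNeuralSigKernel.eq {d : ℕ} {σa σA σb : ℝ}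
    {K L : PathSpace d → PathSpace d → ℝ → ℝ → ℝ} (hK : IsNeuralSigKernel id σa σA σb K)
    (hL : IsNeuralSigKernel id σa σA σb L) (x y : PathSpace d) {s t : ℝ}
    (hs : s ∈ Set.Icc (0 : ℝ) 1) (ht : t ∈ Set.Icc (0 : ℝ) 1) : K x y s t = L x y s t := by
  refine sub_eq_zero.1 (eq_zero_of_eq_integral x y (σA ^ 2) (D := fun s t => K x y s t - L x y s t)
    ((hK.continuousOn x y).sub (hL.continuousOn x y)) (fun s hs t ht => ?_) hs ht)
  have hc {J : PathSpace d → PathSpace d → ℝ → ℝ → ℝ} (hJ : IsNeuralSigKernel id σa σA σb J) :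
      ContinuousOn (fun p : ℝ × ℝ => σA ^ 2 * J x y p.1 p.2 + σb ^ 2)
        (Set.Icc 0 1 ×ˢ Set.Icc 0 1) :=
    (continuousOn_const.mul (hJ.continuousOn x y)).add continuousOn_const
  have he {J : PathSpace d → PathSpace d → ℝ → ℝ → ℝ} (hJ : IsNeuralSigKernel id σa σA σb J) :
      J x y s t = σa ^ 2 + ∫ p, (σA ^ 2 * J x y p.1 p.2 + σb ^ 2) * ⟪dot x p.1, dot y p.2⟫
        ∂((volume.restrict (Set.Ioc 0 s)).prod (volume.restrict (Set.Ioc 0 t))) := by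
    rw [hJ.equation x y s hs t ht, integral_gaussV_id hJ.posSemidef x y hs ht,
      integral_integral_mul_inner_dot x y (F := fun η τ => σA ^ 2 * J x y η τ + σb ^ 2)
        (hc hJ) hs ht]
  rw [he hK, he hL, add_sub_add_left_eq_sub, ← integral_const_mul, ← integral_sub
    (integrable_mul_inner_dot x y (F := fun η τ => σA ^ 2 * K x y η τ + σb ^ 2) (hc hK) hs ht)
    (integrable_mul_inner_dot x y (F := fun η τ => σA ^ 2 * L x y η τ + σb ^ 2) (hc hL) hs ht)]
  refine integral_congr_ae (ae_of_all _ fun p => ?_)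
  ring

theorem integral_inner_dot_smul {d : ℕ} (c : ℝ) (x y : PathSpace d) (F : ℝ → ℝ → ℝ) {s t : ℝ}
    (hs : s ∈ Set.Icc (0 : ℝ) 1) (ht : t ∈ Set.Icc (0 : ℝ) 1) :
    ∫ η in (0 : ℝ)..s, ∫ τ in (0 : ℝ)..t, F η τ * ⟪dot (c • x) η, dot (c • y) τ⟫ =
      c ^ 2 * ∫ η in (0 : ℝ)..s, ∫ τ in (0 : ℝ)..t, F η τ * ⟪dot x η, dot y τ⟫ := by
  have h (z : PathSpace d) {r : ℝ} (hr : r ∈ Set.Icc (0 : ℝ) 1) :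
      ∀ᵐ u, u ∈ Set.uIoc 0 r → dot (c • z) u = c • dot z u := by
    filter_upwards [(ae_restrict_iff' measurableSet_Ioc).1 (dot_smul_ae_eq c z)] with u hu hur
    rw [Set.uIoc_of_le hr.1] at hur
    exact hu ⟨hur.1, hur.2.trans hr.2⟩
  rw [← intervalIntegral.integral_const_mul]
  refine intervalIntegral.integral_congr_ae ((h x hs).mono fun η hη hηs => ?_)
  rw [← intervalIntegral.integral_const_mul]
  refine intervalIntegral.integral_congr_ae ((h y ht).mono fun τ hτ hτt => ?_)
  rw [hη hηs, hτ hτt, real_inner_smul_left, real_inner_smul_right]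
  ring

theorem isNeuralSigKernel_sigKernel {d : ℕ} (σa : ℝ) {σA : ℝ} (hσA : σA ≠ 0) (σb : ℝ) :
    IsNeuralSigKernel (d := d) id σa σA σb fun x y s t =>
      (σa ^ 2 + σb ^ 2 / σA ^ 2) * sigKernel (σA • x) (σA • y) s t - σb ^ 2 / σA ^ 2 := by
  have hpos : ∀ x y : PathSpace d, ∀ s ∈ Set.Icc (0 : ℝ) 1, ∀ t ∈ Set.Icc (0 : ℝ) 1,
      (covMat (fun x y s t => (σa ^ 2 + σb ^ 2 / σA ^ 2) * sigKernel (σA • x) (σA • y) s t -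
        σb ^ 2 / σA ^ 2) x y s t).PosSemidef := by
    intro x y s hs t ht
    refine .of_dotProduct_mulVec_nonneg ?_ fun v => ?_
    · ext i j
      fin_cases i <;> fin_cases j <;> simp [covMat]
    -- The subtracted constant has quadratic form `(σb²/σA²)(v₀ + v₁)²`, so the empty word's share
    -- still leaves `σa²(v₀ + v₁)² ≥ 0`.
    · have h := mul_le_mul_of_nonneg_left
        (sq_add_le_sigKernel_form (σA • x) (σA • y) hs ht (v 0) (v 1))
        (show 0 ≤ σa ^ 2 + σb ^ 2 / σA ^ 2 by positivity)
      have h0 : 0 ≤ σa ^ 2 * (v 0 + v 1) ^ 2 := by positivity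
      simp only [covMat, dotProduct, Matrix.mulVec, Fin.sum_univ_two, Pi.star_apply, star_trivial,
        Matrix.of_apply, Matrix.cons_val_zero, Matrix.cons_val_one, Matrix.cons_val',
        Matrix.cons_val_fin_one]
      linarith
  refine ⟨fun x y => (continuousOn_const.mul (continuousOn_sigKernel _ _)).sub continuousOn_const,
    hpos, fun x y s hs t ht => ?_⟩
  rw [integral_gaussV_id hpos x y hs ht]
  have hfac (η τ : ℝ) : (σA ^ 2 * ((σa ^ 2 + σb ^ 2 / σA ^ 2) * sigKernel (σA • x) (σA • y) η τ -
      σb ^ 2 / σA ^ 2) + σb ^ 2) * ⟪dot x η, dot y τ⟫ =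
      σA ^ 2 * (σa ^ 2 + σb ^ 2 / σA ^ 2) *
        (sigKernel (σA • x) (σA • y) η τ * ⟪dot x η, dot y τ⟫) := by
    field_simp
    ring
  simp_rw [hfac, intervalIntegral.integral_const_mul]
  rw [sigKernel_eq_one_add_integral (σA • x) (σA • y) hs ht,
    integral_inner_dot_smul σA x y (sigKernel (σA • x) (σA • y)) hs ht]
  ring

theorem isNeuralSigKernel_neuralSigKernel_id {d : ℕ} (σa : ℝ) {σA : ℝ} (hσA : σA ≠ 0) (σb : ℝ) :
    IsNeuralSigKernel (d := d) id σa σA σb (neuralSigKernel id σa σA σb) :=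
  Classical.epsilon_spec (p := fun K => IsNeuralSigKernel (d := d) id σa σA σb K)
    ⟨_, isNeuralSigKernel_sigKernel σa hσA σb⟩

end NeuralSig

theorem mainTheorem12 (d : ℕ) (σa σA σb : ℝ) (hσa : 0 < σa) (hσA : 0 < σA) (hσb : 0 ≤ σb) :
    -- the neural signature kernel of the identity activation solves its defining equation
    NeuralSig.IsNeuralSigKernel (d := d) id σa σA σb (NeuralSig.neuralSigKernel id σa σA σb) ∧
    -- and is the only solution on `[0,1]²`
    (∀ K : NeuralSig.PathSpace d → NeuralSig.PathSpace d → ℝ → ℝ → ℝ,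
      NeuralSig.IsNeuralSigKernel id σa σA σb K →
      ∀ x y : NeuralSig.PathSpace d, ∀ s ∈ Set.Icc (0 : ℝ) 1, ∀ t ∈ Set.Icc (0 : ℝ) 1,
        K x y s t = NeuralSig.neuralSigKernel id σa σA σb x y s t) ∧
    -- it is the stated affine transform of the signature kernel, whose series converges
    (∀ x y : NeuralSig.PathSpace d, ∀ s ∈ Set.Icc (0 : ℝ) 1, ∀ t ∈ Set.Icc (0 : ℝ) 1,
      Summable (fun n : ℕ => inner ℝ (NeuralSig.sigLevel (σA • x) n s)
        (NeuralSig.sigLevel (σA • y) n t)) ∧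
      NeuralSig.neuralSigKernel id σa σA σb x y s t =
        (σa ^ 2 + σb ^ 2 / σA ^ 2) * NeuralSig.sigKernel (σA • x) (σA • y) s t -
          σb ^ 2 / σA ^ 2) := by
  have h := NeuralSig.isNeuralSigKernel_neuralSigKernel_id (d := d) σa hσA.ne' σb
  exact ⟨h, fun K hK x y s hs t ht => hK.eq h x y hs ht, fun x y s hs t ht =>
    ⟨NeuralSig.summable_inner_sigLevel _ _ hs ht,
      h.eq (NeuralSig.isNeuralSigKernel_sigKernel σa hσA.ne' σb) x y hs ht⟩⟩
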